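/- For $r>0$, $t>0$ let $$\theta(r,t)=\frac{r}{(2\pi^3t)^{1/2}}\,e^{\pi^2/(2t)}\int_0^\infty e^{-\xi^2/(2t)}\,e^{-r\cosh\xi}\,\sinh(\xi)\,\sin\!\Big(\frac{\pi\xi}{t}\Big)\,d\xi ,$$ and let $a_c(x)=\operatorname{Argcosh}(x)\ge 0$ for $x\ge1$. Let $t>0$. Then for every $x\ge 1$ $$\int_0^\infty e^{-xr}\,\theta(r,t)\,\frac{dr}{r}=\frac1{\sqrt{2\pi t}}\exp\Big(-\frac{a_c(x)^2}{2t}\Big),$$ and for every $x>1$ $$\int_0^\infty e^{-xr}\,\theta(r,t)\,dr=\frac1{\sqrt{2\pi t^3}}\,a_c(x)\,a_c'(x)\exp\Big(-\frac{a_c(x)^2}{2t}\Big).$$ The last formula also holds at $x=1$ if $a_c(x)a_c'(x)$ is replaced there by its limit $\lim_{x\downarrow1}a_c(x)a_c'(x)=1$, that is, $\int_0^\infty e^{-r}\theta(r,t)\,dr=1/\sqrt{2\pi t^3}$. All integrals converge absolutely. -/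

import Mathlib

open MeasureTheory Set Filter Topology

/-- The function `θ(r, t)`, for `r > 0` and `t > 0`:
`θ(r,t) = r / (2π³t)^{1/2} · e^{π²/(2t)} ∫₀^∞ e^{-ξ²/(2t)} e^{-r cosh ξ} sinh ξ sin(πξ/t) dξ`.
For such `r` and `t` the integral converges absolutely. -/
noncomputable def hartmanWatsonTheta (r t : ℝ) : ℝ :=
  r / √(2 * Real.pi ^ 3 * t) * Real.exp (Real.pi ^ 2 / (2 * t)) *
    ∫ ξ in Ioi (0 : ℝ), Real.exp (-ξ ^ 2 / (2 * t)) * Real.exp (-r * Real.cosh ξ) *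
      Real.sinh ξ * Real.sin (Real.pi * ξ / t)

/-! Integrating out `r` by Fubini and writing `x = cosh a` turns the first Laplace transform into
the half-line Gaussian integral of `sinh ξ · sin (πξ/t) / (cosh a + cosh ξ)`. The integrand is even,
and the hyperbolic quotient is the mean of `tanh ((ξ ± a)/2)`, so everything reduces to
`integral_gaussian_sin_tanh`.

That integral comes from Cauchy's theorem for `coth (w/2) · (f w - f 0)`, with `f w = exp (-(a +
w)²/(2t))`, on the rectangle `|Re w| ≤ R`, `|Im w| ≤ π`. Subtracting `f 0` removes the only pole, so
no residue is needed. On the horizontal sides `coth` becomes `tanh` and the difference of the two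
Gaussians yields the sine; as `R → ∞` each vertical side contributes a multiple of `f 0`.

The second formula is minus the `x`-derivative of the first (`hasDerivAt_laplace`). At `x = 1`,
where `arcosh` is not differentiable, it follows by letting `x ↓ 1`. -/

/-! ### The function `coth (w/2)` on the strip `|Im w| ≤ π`. -/

lemma complex_sinh_half_ne_zero {w : ℂ} (hw : w ≠ 0) (him : |w.im| ≤ Real.pi) :
    Complex.sinh (w / 2) ≠ 0 := by
  intro h
  have hd : w / 2 = ((w.re / 2 : ℝ) : ℂ) + ((w.im / 2 : ℝ) : ℂ) * Complex.I := by
    apply Complex.ext <;> simp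
  rw [hd, Complex.sinh_add, Complex.sinh_mul_I, Complex.cosh_mul_I] at h
  have h' : ((Real.sinh (w.re / 2) * Real.cos (w.im / 2) : ℝ) : ℂ)
      + ((Real.cosh (w.re / 2) * Real.sin (w.im / 2) : ℝ) : ℂ) * Complex.I = 0 := by
    rw [← h]; push_cast; ring
  have hre : Real.sinh (w.re / 2) * Real.cos (w.im / 2) = 0 := by
    have := congrArg Complex.re h'
    rwa [Complex.add_re, Complex.ofReal_re, Complex.re_ofReal_mul, Complex.I_re, mul_zero,
      add_zero, Complex.zero_re] at this
  have him' : Real.cosh (w.re / 2) * Real.sin (w.im / 2) = 0 := by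
    have := congrArg Complex.im h'
    rwa [Complex.add_im, Complex.ofReal_im, Complex.im_ofReal_mul, Complex.I_im, mul_one,
      zero_add, Complex.zero_im] at this
  obtain ⟨h1, h2⟩ := abs_le.1 him
  have hpi := Real.pi_pos
  have hsin : Real.sin (w.im / 2) = 0 := by
    rcases mul_eq_zero.1 him' with h | h
    · exact absurd h (Real.cosh_pos _).ne'
    · exact h
  have h0 : w.im = 0 := by
    have := (Real.sin_eq_zero_iff_of_lt_of_lt (by linarith) (by linarith)).1 hsin
    linarith
  rw [h0] at hre
  simp at hre
  exact hw (Complex.ext (by simpa using hre) (by simpa using h0))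

/-- Both `f w - f 0` and `sinh (w/2)` vanish at `0`. Replacing them by their difference quotients
leaves a denominator equal to `1/2` at `0` and nonzero elsewhere in the strip. -/
lemma differentiableOn_complex_coth_mul_sub {f : ℂ → ℂ} (hf : Differentiable ℂ f) :
    ∃ g : ℂ → ℂ, DifferentiableOn ℂ g {w | |w.im| ≤ Real.pi} ∧
      ∀ w ≠ 0, g w = Complex.cosh (w / 2) / Complex.sinh (w / 2) * (f w - f 0) := by
  have hs : Differentiable ℂ (fun w : ℂ => Complex.sinh (w / 2)) := by fun_prop
  have hdf : Differentiable ℂ (dslope f 0) :=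
    differentiableOn_univ.1 ((Complex.differentiableOn_dslope univ_mem).2 hf.differentiableOn)
  have hds : Differentiable ℂ (dslope (fun w : ℂ => Complex.sinh (w / 2)) 0) :=
    differentiableOn_univ.1 ((Complex.differentiableOn_dslope univ_mem).2 hs.differentiableOn)
  refine ⟨fun w => Complex.cosh (w / 2) * dslope f 0 w /
    dslope (fun w : ℂ => Complex.sinh (w / 2)) 0 w, ?_, ?_⟩
  · refine DifferentiableOn.div (by fun_prop) hds.differentiableOn ?_
    intro w hw
    by_cases h0 : w = 0
    · subst h0
      have : HasDerivAt (fun w : ℂ => Complex.sinh (w / 2)) (Complex.cosh (0 / 2) * (1 / 2)) 0 :=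
        ((hasDerivAt_id (0 : ℂ)).div_const 2).csinh
      rw [dslope_same, this.deriv]
      simp
    · rw [dslope_of_ne _ h0, slope_def_field]
      simpa using ⟨complex_sinh_half_ne_zero h0 hw, h0⟩
  · intro w hw
    beta_reduce
    rw [dslope_of_ne _ hw, dslope_of_ne _ hw, slope_def_field, slope_def_field]
    simp
    field_simp

lemma complex_coth_half_eq {w : ℂ} (hw : 0 < w.re) :
    Complex.cosh (w / 2) / Complex.sinh (w / 2) = 1 + 2 / (Complex.exp w - 1) := by
  have he : Complex.exp w - 1 ≠ 0 := by
    intro h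
    have h1 : ‖Complex.exp w‖ = 1 := by rw [sub_eq_zero.1 h]; simp
    rw [Complex.norm_exp, Real.exp_eq_one_iff] at h1
    exact hw.ne' h1
  have hx : Complex.exp w = Complex.exp (w / 2) * Complex.exp (w / 2) := by
    rw [← Complex.exp_add]; ring_nf
  have hn := Complex.exp_ne_zero (w / 2)
  have hi : Complex.exp (w / 2) * Complex.exp (-(w / 2)) = 1 := by
    rw [← Complex.exp_add]; simp
  have hsh : 2 * Complex.sinh (w / 2) * Complex.exp (w / 2) = Complex.exp w - 1 := by
    rw [Complex.two_sinh, hx]; linear_combination -hi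
  have hch : 2 * Complex.cosh (w / 2) * Complex.exp (w / 2) = Complex.exp w + 1 := by
    rw [Complex.two_cosh, hx]; linear_combination hi
  have hs0 : Complex.sinh (w / 2) ≠ 0 := by
    intro h; rw [h] at hsh; simp at hsh; exact he hsh.symm
  have : Complex.cosh (w / 2) / Complex.sinh (w / 2)
      = (2 * Complex.cosh (w / 2) * Complex.exp (w / 2)) /
        (2 * Complex.sinh (w / 2) * Complex.exp (w / 2)) := by field_simp
  rw [this, hsh, hch]
  field_simp
  ring

/-- `coth (w/2) - 1 = 2/(e^w - 1)`, and `|e^w - 1| ≥ e^(Re w) - 1 ≥ Re w`. -/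
lemma norm_complex_coth_half_sub_one_le {w : ℂ} (hw : 0 < w.re) :
    ‖Complex.cosh (w / 2) / Complex.sinh (w / 2) - 1‖ ≤ 2 / w.re := by
  rw [complex_coth_half_eq hw, add_sub_cancel_left, norm_div]
  have h1 : w.re ≤ ‖Complex.exp w - 1‖ := by
    have := norm_sub_norm_le (Complex.exp w) 1
    rw [Complex.norm_exp, norm_one] at this
    linarith [Real.add_one_le_exp w.re]
  simp only [Complex.norm_ofNat]
  gcongr

/-! ### Vertical sides of the rectangle. -/

lemma norm_complex_exp_neg_sq_div (a t R y : ℝ) :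
    ‖Complex.exp (-((a : ℂ) + (R + y * Complex.I)) ^ 2 / (2 * t))‖
      = Real.exp ((y ^ 2 - (a + R) ^ 2) / (2 * t)) := by
  rw [Complex.norm_exp]
  congr 1
  have : -((a : ℂ) + (R + y * Complex.I)) ^ 2 / (2 * t)
      = (((y ^ 2 - (a + R) ^ 2) / (2 * t) : ℝ) : ℂ)
        + ((-(2 * (a + R) * y) / (2 * t) : ℝ) : ℂ) * Complex.I := by
    push_cast
    linear_combination (-(y : ℂ) ^ 2 / (2 * t)) * Complex.I_sq
  rw [this, Complex.add_re, Complex.ofReal_re, Complex.re_ofReal_mul, Complex.I_re, mul_zero,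
    add_zero]

/-- Far to the right `coth` tends to `1` and the Gaussian to `0`, so only the subtracted constant
survives, over a segment of length `2π`. -/
lemma tendsto_integral_side (a : ℝ) {t : ℝ} (ht : 0 < t) :
    Tendsto (fun R : ℝ => ∫ y in (-Real.pi)..Real.pi,
      Complex.cosh ((R + y * Complex.I) / 2) / Complex.sinh ((R + y * Complex.I) / 2) *
        (Complex.exp (-((a : ℂ) + (R + y * Complex.I)) ^ 2 / (2 * t))
          - Complex.exp (-(a : ℂ) ^ 2 / (2 * t)))) atTop
      (𝓝 (-(2 * Real.pi * Complex.exp (-(a : ℂ) ^ 2 / (2 * t))))) := by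
  have hpi := Real.pi_pos
  have hlim : -(2 * Real.pi * Complex.exp (-(a : ℂ) ^ 2 / (2 * t)))
      = ∫ y in (-Real.pi)..Real.pi, (1 : ℂ) * (0 - Complex.exp (-(a : ℂ) ^ 2 / (2 * t))) := by
    rw [intervalIntegral.integral_const]
    simp only [Complex.real_smul]
    push_cast
    ring
  rw [hlim]
  have hre : ∀ R y : ℝ, ((R : ℂ) + y * Complex.I).re = R := by intro R y; simp
  -- The factor `3` bounds `|coth| ≤ 1 + 2/R` for `R ≥ 1`.
  refine intervalIntegral.tendsto_integral_filter_of_dominated_convergence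
    (fun _ => 3 * (Real.exp (Real.pi ^ 2 / (2 * t)) + ‖Complex.exp (-(a : ℂ) ^ 2 / (2 * t))‖))
    ?_ ?_ ?_ ?_
  · refine Eventually.of_forall fun R => ?_
    refine Measurable.aestronglyMeasurable ?_
    have h1 : Measurable fun y : ℝ => Complex.cosh ((R + y * Complex.I) / 2) := by
      apply Continuous.measurable; fun_prop
    have h2 : Measurable fun y : ℝ => Complex.sinh ((R + y * Complex.I) / 2) := by
      apply Continuous.measurable; fun_prop
    have h3 : Measurable fun y : ℝ =>
        Complex.exp (-((a : ℂ) + (R + y * Complex.I)) ^ 2 / (2 * t))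
          - Complex.exp (-(a : ℂ) ^ 2 / (2 * t)) := by
      apply Continuous.measurable; fun_prop
    exact (h1.div h2).mul h3
  · filter_upwards [eventually_ge_atTop 1] with R hR
    refine ae_of_all _ fun y hy => ?_
    rw [uIoc_of_le (by linarith)] at hy
    rw [norm_mul]
    have hb := norm_complex_coth_half_sub_one_le (w := R + y * Complex.I) (by rw [hre]; linarith)
    rw [hre] at hb
    have hb2 : 2 / R ≤ 2 := by rw [div_le_iff₀ (by linarith)]; linarith
    have hb3 : ‖Complex.cosh ((R + y * Complex.I) / 2) / Complex.sinh ((R + y * Complex.I) / 2)‖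
        ≤ 3 := by
      have := norm_sub_norm_le
        (Complex.cosh ((R + y * Complex.I) / 2) / Complex.sinh ((R + y * Complex.I) / 2)) 1
      rw [norm_one] at this
      linarith
    refine mul_le_mul hb3 ((norm_sub_le _ _).trans ?_) (norm_nonneg _) (by norm_num)
    rw [norm_complex_exp_neg_sq_div]
    gcongr
    nlinarith [sq_nonneg (a + R), hy.1, hy.2]
  · exact intervalIntegrable_const
  · refine ae_of_all _ fun y _ => ?_
    refine Tendsto.mul ?_ (Tendsto.sub ?_ tendsto_const_nhds)
    · rw [tendsto_iff_norm_sub_tendsto_zero]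
      refine squeeze_zero' (Eventually.of_forall fun _ => norm_nonneg _) ?_
        (tendsto_const_nhds (x := (2 : ℝ)).div_atTop tendsto_id)
      filter_upwards [eventually_gt_atTop 0] with R hR
      have hb := norm_complex_coth_half_sub_one_le (w := R + y * Complex.I) (by rw [hre]; linarith)
      rwa [hre] at hb
    · rw [tendsto_zero_iff_norm_tendsto_zero]
      simp only [norm_complex_exp_neg_sq_div]
      refine Real.tendsto_exp_atBot.comp ?_
      refine Tendsto.atBot_div_const (by positivity) ?_
      refine tendsto_atBot_add_const_left _ _ (tendsto_neg_atTop_atBot.comp ?_)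
      exact (tendsto_pow_atTop two_ne_zero).comp (tendsto_atTop_add_const_left _ _ tendsto_id)

/-! ### Horizontal sides of the rectangle. -/

lemma complex_coth_half_add_pi (u : ℝ) :
    Complex.cosh ((u + Real.pi * Complex.I) / 2) / Complex.sinh ((u + Real.pi * Complex.I) / 2)
      = Real.tanh (u / 2) := by
  have h : ((u : ℂ) + Real.pi * Complex.I) / 2 = ((u / 2 : ℝ) : ℂ) + (Real.pi / 2 : ℂ) * Complex.I := by
    push_cast; ring
  rw [h, Complex.cosh_add, Complex.sinh_add, Complex.cosh_mul_I, Complex.sinh_mul_I,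
    Complex.cos_pi_div_two, Complex.sin_pi_div_two, Real.tanh_eq_sinh_div_cosh]
  push_cast
  simp [mul_div_mul_right _ _ Complex.I_ne_zero]

lemma complex_coth_half_sub_pi (u : ℝ) :
    Complex.cosh ((u + (-Real.pi : ℝ) * Complex.I) / 2) /
      Complex.sinh ((u + (-Real.pi : ℝ) * Complex.I) / 2) = Real.tanh (u / 2) := by
  have h : ((u : ℂ) + (-Real.pi : ℝ) * Complex.I) / 2
      = -(((-u : ℝ) + Real.pi * Complex.I) / 2) := by
    push_cast; ring
  rw [h, Complex.cosh_neg, Complex.sinh_neg, div_neg, complex_coth_half_add_pi, neg_div,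
    Real.tanh_neg]
  simp

lemma complex_exp_shift_sub (t v : ℝ) :
    Complex.exp (-((v : ℂ) + (-Real.pi : ℝ) * Complex.I) ^ 2 / (2 * t))
      - Complex.exp (-((v : ℂ) + Real.pi * Complex.I) ^ 2 / (2 * t))
      = (2 * Real.exp (Real.pi ^ 2 / (2 * t)) *
        (Real.exp (-v ^ 2 / (2 * t)) * Real.sin (Real.pi * v / t)) : ℝ) * Complex.I := by
  have h1 : -((v : ℂ) + (-Real.pi : ℝ) * Complex.I) ^ 2 / (2 * t)
      = ((Real.pi ^ 2 / (2 * t) : ℝ) : ℂ) + ((-v ^ 2 / (2 * t) : ℝ) : ℂ)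
        + ((Real.pi * v / t : ℝ) : ℂ) * Complex.I := by
    push_cast
    linear_combination (-(Real.pi : ℂ) ^ 2 / (2 * t)) * Complex.I_sq
  have h2 : -((v : ℂ) + Real.pi * Complex.I) ^ 2 / (2 * t)
      = ((Real.pi ^ 2 / (2 * t) : ℝ) : ℂ) + ((-v ^ 2 / (2 * t) : ℝ) : ℂ)
        + ((-(Real.pi * v / t) : ℝ) : ℂ) * Complex.I := by
    push_cast
    linear_combination (-(Real.pi : ℂ) ^ 2 / (2 * t)) * Complex.I_sq
  rw [h1, h2]
  simp only [Complex.exp_add, Complex.exp_mul_I]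
  push_cast
  rw [Complex.cos_neg, Complex.sin_neg]
  ring

lemma abs_tanh_le_one (x : ℝ) : |Real.tanh x| ≤ 1 := by
  rw [Real.tanh_eq_sinh_div_cosh, abs_div, abs_of_pos (Real.cosh_pos x),
    div_le_one (Real.cosh_pos x), abs_le]
  constructor
  · have := Real.exp_pos x
    rw [← Real.cosh_add_sinh] at this
    linarith
  · have := Real.exp_pos (-x)
    rw [← Real.cosh_sub_sinh] at this
    linarith

lemma continuous_real_tanh : Continuous Real.tanh := by
  have : Real.tanh = fun x => Real.sinh x / Real.cosh x := by
    ext x; exact Real.tanh_eq_sinh_div_cosh x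
  rw [this]
  exact Real.continuous_sinh.div Real.continuous_cosh fun x => (Real.cosh_pos x).ne'

/-! ### The contour integral and its limit. -/

lemma integrable_gaussian_mul_of_abs_le_one {t : ℝ} (ht : 0 < t) {g : ℝ → ℝ}
    (hg : AEStronglyMeasurable g) (hb : ∀ x, |g x| ≤ 1) :
    Integrable fun v : ℝ => Real.exp (-v ^ 2 / (2 * t)) * g v := by
  have h := integrable_exp_neg_mul_sq (b := 1 / (2 * t)) (by positivity)
  have h' : Integrable fun v : ℝ => Real.exp (-v ^ 2 / (2 * t)) := by
    refine h.congr (ae_of_all _ fun v => ?_)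
    beta_reduce
    congr 1
    ring
  exact h'.mul_bdd (c := 1) hg (ae_of_all _ hb)

lemma integrable_gaussian_sin_tanh {t : ℝ} (ht : 0 < t) (a : ℝ) :
    Integrable fun v : ℝ => Real.exp (-v ^ 2 / (2 * t)) *
      (Real.sin (Real.pi * v / t) * Real.tanh ((v - a) / 2)) := by
  have := continuous_real_tanh
  refine integrable_gaussian_mul_of_abs_le_one ht
    (Continuous.aestronglyMeasurable (by fun_prop)) fun x => ?_
  rw [abs_mul]
  exact mul_le_one₀ (Real.abs_sin_le_one _) (abs_nonneg _) (abs_tanh_le_one _)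

lemma gaussian_coth_rect_integral_eq_zero (a t : ℝ) {R : ℝ} (hR : 0 < R) :
    (((2 * Real.exp (Real.pi ^ 2 / (2 * t)) * ∫ u in (-R)..R,
      Real.exp (-(a + u) ^ 2 / (2 * t)) *
        (Real.sin (Real.pi * (a + u) / t) * Real.tanh (u / 2))) : ℝ) : ℂ) +
    (∫ y in (-Real.pi)..Real.pi,
      Complex.cosh ((R + y * Complex.I) / 2) / Complex.sinh ((R + y * Complex.I) / 2) *
        (Complex.exp (-((a : ℂ) + (R + y * Complex.I)) ^ 2 / (2 * t))
          - Complex.exp (-(a : ℂ) ^ 2 / (2 * t)))) +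
    (∫ y in (-Real.pi)..Real.pi,
      Complex.cosh ((R + y * Complex.I) / 2) / Complex.sinh ((R + y * Complex.I) / 2) *
        (Complex.exp (-(((-a : ℝ) : ℂ) + (R + y * Complex.I)) ^ 2 / (2 * t))
          - Complex.exp (-((-a : ℝ) : ℂ) ^ 2 / (2 * t)))) = 0 := by
  have hpi := Real.pi_pos
  obtain ⟨g, hg, hgeq⟩ := differentiableOn_complex_coth_mul_sub
    (f := fun w => Complex.exp (-((a : ℂ) + w) ^ 2 / (2 * t))) (by fun_prop)
  simp only [add_zero] at hgeq
  have hC := Complex.integral_boundary_rect_eq_zero_of_differentiableOn g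
    ⟨-R, -Real.pi⟩ ⟨R, Real.pi⟩ (hg.mono ?_)
  swap
  · rintro w ⟨-, hw⟩
    simp only [mem_preimage, uIcc_of_le (show -Real.pi ≤ Real.pi by linarith), mem_Icc] at hw
    exact abs_le.2 hw
  simp only at hC
  have hgR : ∀ y : ℝ, g ((R : ℂ) + y * Complex.I) = _ := fun y => hgeq _ (by
    intro h; have := congrArg Complex.re h; simp at this; exact hR.ne' this)
  -- The reflection `w ↦ -w` turns the left side into a right side with `a` replaced by `-a`, so one
  -- limit lemma serves both.
  have hgL : ∀ y : ℝ, g (((-R : ℝ) : ℂ) + y * Complex.I) =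
      -(Complex.cosh ((R + (-y : ℝ) * Complex.I) / 2) /
        Complex.sinh ((R + (-y : ℝ) * Complex.I) / 2) *
        (Complex.exp (-(((-a : ℝ) : ℂ) + (R + (-y : ℝ) * Complex.I)) ^ 2 / (2 * t))
          - Complex.exp (-((-a : ℝ) : ℂ) ^ 2 / (2 * t)))) := fun y => by
    rw [hgeq _ (by intro h; have := congrArg Complex.re h; simp at this; exact hR.ne' this)]
    have h1 : (((-R : ℝ) : ℂ) + y * Complex.I) / 2 = -((R + (-y : ℝ) * Complex.I) / 2) := by
      push_cast; ring
    have h2 : ((a : ℂ) + (((-R : ℝ) : ℂ) + y * Complex.I)) ^ 2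
        = (((-a : ℝ) : ℂ) + (R + (-y : ℝ) * Complex.I)) ^ 2 := by
      push_cast; ring
    have h3 : (a : ℂ) ^ 2 = ((-a : ℝ) : ℂ) ^ 2 := by push_cast; ring
    rw [h1, h2, h3, Complex.cosh_neg, Complex.sinh_neg, div_neg, neg_mul]
  -- Both horizontal sides carry the same factor `tanh (u/2)`, so the constant `f 0` cancels in
  -- their difference.
  have hgH : (∫ x in (-R)..R, g ((x : ℂ) + ((-Real.pi : ℝ) : ℂ) * Complex.I)) -
      (∫ x in (-R)..R, g ((x : ℂ) + (Real.pi : ℂ) * Complex.I)) =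
      ((2 * Real.exp (Real.pi ^ 2 / (2 * t)) * ∫ u in (-R)..R,
      Real.exp (-(a + u) ^ 2 / (2 * t)) *
        (Real.sin (Real.pi * (a + u) / t) * Real.tanh (u / 2)) : ℝ) : ℂ) * Complex.I := by
    have hne : ∀ x p : ℝ, p ≠ 0 → (x : ℂ) + (p : ℂ) * Complex.I ≠ 0 := by
      intro x p hp h
      have := congrArg Complex.im h
      simp at this
      exact hp this
    have hint : ∀ p : ℝ, |p| ≤ Real.pi →
        IntervalIntegrable (fun x : ℝ => g ((x : ℂ) + (p : ℂ) * Complex.I)) volume (-R) R := by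
      intro p hp
      refine Continuous.intervalIntegrable ?_ _ _
      refine hg.continuousOn.comp_continuous (by fun_prop) fun x => ?_
      simpa using hp
    rw [← intervalIntegral.integral_sub (hint _ (by rw [abs_neg, abs_of_pos hpi]))
      (hint _ (by rw [abs_of_pos hpi])), ← intervalIntegral.integral_const_mul,
      ← intervalIntegral.integral_ofReal, ← intervalIntegral.integral_mul_const]
    refine intervalIntegral.integral_congr fun u _ => ?_
    rw [hgeq _ (hne u _ (by linarith)), hgeq _ (hne u _ hpi.ne'), complex_coth_half_add_pi,
      complex_coth_half_sub_pi]
    have := complex_exp_shift_sub t (a + u)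
    rw [← mul_sub, sub_sub_sub_cancel_right]
    simp only [← add_assoc]
    push_cast at this ⊢
    rw [this]
    ring
  have hL : ∫ y in (-Real.pi)..Real.pi, g (((-R : ℝ) : ℂ) + y * Complex.I) =
      -∫ y in (-Real.pi)..Real.pi,
      Complex.cosh ((R + y * Complex.I) / 2) / Complex.sinh ((R + y * Complex.I) / 2) *
        (Complex.exp (-(((-a : ℝ) : ℂ) + (R + y * Complex.I)) ^ 2 / (2 * t))
          - Complex.exp (-((-a : ℝ) : ℂ) ^ 2 / (2 * t))) := by
    simp only [hgL, intervalIntegral.integral_neg]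
    rw [intervalIntegral.integral_comp_neg (fun y : ℝ =>
      Complex.cosh ((R + y * Complex.I) / 2) / Complex.sinh ((R + y * Complex.I) / 2) *
        (Complex.exp (-(((-a : ℝ) : ℂ) + (R + y * Complex.I)) ^ 2 / (2 * t))
          - Complex.exp (-((-a : ℝ) : ℂ) ^ 2 / (2 * t)))), neg_neg]
  rw [hgH, hL] at hC
  simp only [hgR, smul_eq_mul] at hC
  refine mul_left_cancel₀ Complex.I_ne_zero ?_
  rw [mul_zero, ← hC]
  ring

/-- The Gaussian integral of `sin (π v / t) tanh ((v - a) / 2)`. -/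
lemma integral_gaussian_sin_tanh {t : ℝ} (ht : 0 < t) (a : ℝ) :
    ∫ v : ℝ, Real.exp (-v ^ 2 / (2 * t)) *
      (Real.sin (Real.pi * v / t) * Real.tanh ((v - a) / 2)) =
    2 * Real.pi * Real.exp (-Real.pi ^ 2 / (2 * t)) * Real.exp (-a ^ 2 / (2 * t)) := by
  have hint := (integrable_gaussian_sin_tanh ht a).comp_add_left a
  simp only [add_sub_cancel_left] at hint
  rw [← integral_add_left_eq_self _ a]
  simp only [add_sub_cancel_left]
  set J := ∫ u : ℝ, Real.exp (-(a + u) ^ 2 / (2 * t)) *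
        (Real.sin (Real.pi * (a + u) / t) * Real.tanh (u / 2)) with hJ
  have h1 : Tendsto (fun R : ℝ => ((2 * Real.exp (Real.pi ^ 2 / (2 * t)) * ∫ u in (-R)..R,
      Real.exp (-(a + u) ^ 2 / (2 * t)) *
        (Real.sin (Real.pi * (a + u) / t) * Real.tanh (u / 2)) : ℝ) : ℂ)) atTop
      (𝓝 ((2 * Real.exp (Real.pi ^ 2 / (2 * t)) * J : ℝ) : ℂ)) := by
    refine (Complex.continuous_ofReal.tendsto _).comp (Tendsto.const_mul _ ?_)
    exact intervalIntegral_tendsto_integral hint tendsto_neg_atTop_atBot tendsto_id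
  have h2 := (h1.add (tendsto_integral_side a ht)).add (tendsto_integral_side (-a) ht)
  have h3 := tendsto_nhds_unique (h2.congr' (f₂ := fun _ => (0 : ℂ)) (by
    filter_upwards [eventually_gt_atTop 0] with R hR
    exact gaussian_coth_rect_integral_eq_zero a t hR)) tendsto_const_nhds
  have h4 : 2 * Real.exp (Real.pi ^ 2 / (2 * t)) * J
      = 4 * Real.pi * Real.exp (-a ^ 2 / (2 * t)) := by
    have h5 : ((-a : ℝ) : ℂ) ^ 2 = (a : ℂ) ^ 2 := by push_cast; ring
    rw [h5] at h3
    apply Complex.ofReal_injective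
    push_cast at h3 ⊢
    linear_combination h3
  have h6 : Real.exp (-Real.pi ^ 2 / (2 * t)) * Real.exp (Real.pi ^ 2 / (2 * t)) = 1 := by
    rw [← Real.exp_add, neg_div, neg_add_cancel, Real.exp_zero]
  linear_combination (Real.exp (-Real.pi ^ 2 / (2 * t)) / 2) * h4 - J * h6

/-! ### Reduction of the half-line integral to the full line. -/

lemma sinh_div_cosh_add_cosh (a ξ : ℝ) :
    Real.sinh ξ / (Real.cosh a + Real.cosh ξ)
      = (Real.tanh ((ξ - -a) / 2) + Real.tanh ((ξ - a) / 2)) / 2 := by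
  have h1 := Real.cosh_pos ((ξ - -a) / 2)
  have h2 := Real.cosh_pos ((ξ - a) / 2)
  have h3 := Real.cosh_pos a
  have h4 := Real.cosh_pos ξ
  have hs : Real.sinh ξ = Real.sinh ((ξ - -a) / 2) * Real.cosh ((ξ - a) / 2)
      + Real.cosh ((ξ - -a) / 2) * Real.sinh ((ξ - a) / 2) := by
    rw [← Real.sinh_add]; ring_nf
  have hc : Real.cosh a + Real.cosh ξ
      = 2 * (Real.cosh ((ξ - -a) / 2) * Real.cosh ((ξ - a) / 2)) := by
    have e1 : Real.cosh ξ = Real.cosh ((ξ - -a) / 2 + (ξ - a) / 2) := by ring_nf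
    have e2 : Real.cosh a = Real.cosh ((ξ - -a) / 2 - (ξ - a) / 2) := by ring_nf
    rw [e1, e2, Real.cosh_add, Real.cosh_sub]; ring
  rw [hs, hc, Real.tanh_eq_sinh_div_cosh, Real.tanh_eq_sinh_div_cosh]
  field_simp

lemma integral_Ioi_gaussian_sinh_sin_div {t : ℝ} (ht : 0 < t) (a : ℝ) :
    ∫ ξ in Ioi (0 : ℝ), Real.exp (-ξ ^ 2 / (2 * t)) * Real.sinh ξ * Real.sin (Real.pi * ξ / t) /
      (Real.cosh a + Real.cosh ξ) =
    Real.pi * Real.exp (-Real.pi ^ 2 / (2 * t)) * Real.exp (-a ^ 2 / (2 * t)) := by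
  set F : ℝ → ℝ := fun ξ => Real.exp (-ξ ^ 2 / (2 * t)) * Real.sinh ξ *
    Real.sin (Real.pi * ξ / t) / (Real.cosh a + Real.cosh ξ) with hF
  have hFabs : ∀ ξ, F |ξ| = F ξ := by
    intro ξ
    rcases abs_choice ξ with h | h
    · rw [h]
    · rw [h]
      simp only [hF, neg_sq, Real.sinh_neg, Real.cosh_neg, mul_neg, neg_div, Real.sin_neg,
        neg_mul, neg_neg]
  have h1 := integral_comp_abs (f := F)
  simp only [hFabs] at h1
  have h2 : ∀ ξ, F ξ = (1 / 2) * (Real.exp (-ξ ^ 2 / (2 * t)) *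
      (Real.sin (Real.pi * ξ / t) * Real.tanh ((ξ - -a) / 2)) +
      Real.exp (-ξ ^ 2 / (2 * t)) *
      (Real.sin (Real.pi * ξ / t) * Real.tanh ((ξ - a) / 2))) := by
    intro ξ
    have := sinh_div_cosh_add_cosh a ξ
    simp only [hF]
    linear_combination (Real.exp (-ξ ^ 2 / (2 * t)) * Real.sin (Real.pi * ξ / t)) * this
  have h3 : ∫ ξ, F ξ = 2 * Real.pi * Real.exp (-Real.pi ^ 2 / (2 * t)) *
      Real.exp (-a ^ 2 / (2 * t)) := by
    simp only [h2]
    rw [integral_const_mul, integral_add (integrable_gaussian_sin_tanh ht (-a))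
      (integrable_gaussian_sin_tanh ht a), integral_gaussian_sin_tanh ht,
      integral_gaussian_sin_tanh ht, neg_sq]
    ring
  linarith

/-! ### Fubini and the first formula. -/

/-- After the `r`-integration the Gaussian alone dominates, since `|sinh ξ| ≤ cosh ξ ≤ x + cosh ξ`.
This already works at `x = 0`. -/
lemma integrable_prod_gaussian_sinh_sin {t : ℝ} (ht : 0 < t) {x : ℝ} (hx : 0 ≤ x) :
    Integrable (Function.uncurry fun r ξ : ℝ => Real.exp (-(x + Real.cosh ξ) * r) *
      (Real.exp (-ξ ^ 2 / (2 * t)) * Real.sinh ξ * Real.sin (Real.pi * ξ / t)))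
      ((volume.restrict (Ioi 0)).prod (volume.restrict (Ioi 0))) := by
  have hpos : ∀ ξ, 0 < x + Real.cosh ξ := fun ξ => by linarith [Real.cosh_pos ξ]
  have hcont : Continuous (Function.uncurry fun r ξ : ℝ => Real.exp (-(x + Real.cosh ξ) * r) *
      (Real.exp (-ξ ^ 2 / (2 * t)) * Real.sinh ξ * Real.sin (Real.pi * ξ / t))) := by
    simp only [Function.uncurry_def]
    have := Real.continuous_cosh
    have := Real.continuous_sinh
    fun_prop
  rw [integrable_prod_iff' hcont.aestronglyMeasurable]
  have hexp : ∀ ξ : ℝ, ∫ r in Ioi (0 : ℝ), Real.exp (-(x + Real.cosh ξ) * r)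
      = 1 / (x + Real.cosh ξ) := fun ξ => by
    rw [integral_exp_mul_Ioi (by linarith [hpos ξ]), mul_zero, Real.exp_zero, neg_div_neg_eq]
  refine ⟨ae_of_all _ fun ξ => ?_, ?_⟩
  · simp only [Function.uncurry_apply_pair]
    exact (integrableOn_exp_mul_Ioi (by linarith [hpos ξ]) 0).mul_const _
  · simp only [Function.uncurry_apply_pair, norm_mul]
    simp only [integral_mul_const, Real.norm_eq_abs, Real.abs_exp, hexp]
    have hint := integrable_gaussian_mul_of_abs_le_one ht
      (g := fun ξ => |Real.sinh ξ| * |Real.sin (Real.pi * ξ / t)| / (x + Real.cosh ξ)) ?_ ?_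
    · refine (hint.integrableOn (s := Ioi 0)).congr (ae_of_all _ fun ξ => ?_)
      beta_reduce
      ring
    · refine Continuous.aestronglyMeasurable (Continuous.div ?_ ?_ fun ξ => (hpos ξ).ne')
      · have := Real.continuous_sinh
        fun_prop
      · have := Real.continuous_cosh
        fun_prop
    · intro ξ
      rw [abs_of_nonneg (div_nonneg (by positivity) (hpos ξ).le), div_le_one (hpos ξ)]
      have h1 : |Real.sinh ξ| ≤ Real.cosh ξ :=
        abs_le_of_sq_le_sq (by rw [Real.cosh_sq]; linarith) (Real.cosh_pos ξ).le
      have h2 := Real.abs_sin_le_one (Real.pi * ξ / t)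
      nlinarith [abs_nonneg (Real.sinh ξ)]

lemma exp_mul_hartmanWatsonTheta_div {t r : ℝ} (hr : 0 < r) (x : ℝ) :
    Real.exp (-x * r) * hartmanWatsonTheta r t / r =
      Real.exp (Real.pi ^ 2 / (2 * t)) / √(2 * Real.pi ^ 3 * t) *
      ∫ ξ in Ioi (0 : ℝ), Real.exp (-(x + Real.cosh ξ) * r) *
      (Real.exp (-ξ ^ 2 / (2 * t)) * Real.sinh ξ * Real.sin (Real.pi * ξ / t)) := by
  have h : ∀ ξ : ℝ, Real.exp (-(x + Real.cosh ξ) * r) *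
      (Real.exp (-ξ ^ 2 / (2 * t)) * Real.sinh ξ * Real.sin (Real.pi * ξ / t)) =
      Real.exp (-x * r) * (Real.exp (-ξ ^ 2 / (2 * t)) * Real.exp (-r * Real.cosh ξ) *
      Real.sinh ξ * Real.sin (Real.pi * ξ / t)) := fun ξ => by
    have : -(x + Real.cosh ξ) * r = -x * r + -r * Real.cosh ξ := by ring
    rw [this, Real.exp_add]
    ring
  simp only [h]
  rw [integral_const_mul, hartmanWatsonTheta]
  field_simp

lemma integrableOn_exp_mul_hartmanWatsonTheta_div {t : ℝ} (ht : 0 < t) {x : ℝ} (hx : 0 ≤ x) :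
    IntegrableOn (fun r : ℝ => Real.exp (-x * r) * hartmanWatsonTheta r t / r) (Ioi 0) := by
  have h := (integrable_prod_gaussian_sinh_sin ht hx).integral_prod_left.const_mul
    (Real.exp (Real.pi ^ 2 / (2 * t)) / √(2 * Real.pi ^ 3 * t))
  refine IntegrableOn.congr_fun h (fun r hr => ?_) measurableSet_Ioi
  exact (exp_mul_hartmanWatsonTheta_div hr x).symm

lemma integral_exp_mul_hartmanWatsonTheta_div {t : ℝ} (ht : 0 < t) {x : ℝ} (hx : 1 ≤ x) :
    ∫ r in Ioi (0 : ℝ), Real.exp (-x * r) * hartmanWatsonTheta r t / r =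
      1 / √(2 * Real.pi * t) * Real.exp (-(Real.arcosh x) ^ 2 / (2 * t)) := by
  have hpi := Real.pi_pos
  rw [setIntegral_congr_fun measurableSet_Ioi
    (fun r hr => exp_mul_hartmanWatsonTheta_div (t := t) hr x), integral_const_mul,
    integral_integral_swap (integrable_prod_gaussian_sinh_sin ht (by linarith))]
  have h : ∀ ξ : ℝ, ∫ r in Ioi (0 : ℝ), Real.exp (-(x + Real.cosh ξ) * r) *
      (Real.exp (-ξ ^ 2 / (2 * t)) * Real.sinh ξ * Real.sin (Real.pi * ξ / t)) =
      Real.exp (-ξ ^ 2 / (2 * t)) * Real.sinh ξ * Real.sin (Real.pi * ξ / t) /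
      (Real.cosh (Real.arcosh x) + Real.cosh ξ) := fun ξ => by
    have hc := Real.cosh_pos ξ
    rw [integral_mul_const, integral_exp_mul_Ioi (by linarith), Real.cosh_arcosh hx, mul_zero, Real.exp_zero,
      neg_div_neg_eq]
    ring
  simp only [h]
  rw [integral_Ioi_gaussian_sinh_sin_div ht]
  have hs : √(2 * Real.pi ^ 3 * t) = Real.pi * √(2 * Real.pi * t) := by
    rw [show 2 * Real.pi ^ 3 * t = Real.pi ^ 2 * (2 * Real.pi * t) by ring,
      Real.sqrt_mul (by positivity), Real.sqrt_sq hpi.le]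
  have he : Real.exp (Real.pi ^ 2 / (2 * t)) * Real.exp (-(Real.pi ^ 2 / (2 * t))) = 1 := by
    rw [← Real.exp_add, add_neg_cancel, Real.exp_zero]
  have h0 : 0 < √(2 * Real.pi * t) := by positivity
  rw [hs, neg_div _ (Real.pi ^ 2)]
  field_simp
  linear_combination he

/-! ### Differentiation and boundary continuity of Laplace transforms. -/

lemma mul_exp_neg_mul_le {x r : ℝ} (hx : 0 < x) : r * Real.exp (-x * r) ≤ 1 / x := by
  rw [le_div_iff₀ hx, neg_mul, Real.exp_neg]
  have h1 := Real.add_one_le_exp (x * r)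
  have h2 := Real.exp_pos (x * r)
  calc r * (Real.exp (x * r))⁻¹ * x = (x * r) / Real.exp (x * r) := by field_simp
    _ ≤ 1 := by rw [div_le_one h2]; linarith

section LaplaceTransform

variable {φ : ℝ → ℝ}

/-- For `y > x/2` one has `r e^(-yr) ≤ 1/y ≤ 2/x`, so a multiple of `|φ|` dominates the
differentiated integrand. -/
lemma hasDerivAt_laplace (hφ : IntegrableOn φ (Ioi 0)) {x : ℝ} (hx : 0 < x) :
    IntegrableOn (fun r => Real.exp (-x * r) * (r * φ r)) (Ioi 0) ∧
    HasDerivAt (fun y => ∫ r in Ioi (0 : ℝ), Real.exp (-y * r) * φ r)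
      (-∫ r in Ioi (0 : ℝ), Real.exp (-x * r) * (r * φ r)) x := by
  have hmeas : ∀ y : ℝ, AEStronglyMeasurable (fun r => Real.exp (-y * r) * φ r)
      (volume.restrict (Ioi 0)) := fun y =>
    (Continuous.aestronglyMeasurable (by fun_prop)).mul hφ.aestronglyMeasurable
  have h := hasDerivAt_integral_of_dominated_loc_of_deriv_le (𝕜 := ℝ)
    (μ := volume.restrict (Ioi (0 : ℝ)))
    (F := fun y r => Real.exp (-y * r) * φ r)
    (F' := fun y r => -(Real.exp (-y * r) * (r * φ r))) (x₀ := x) (s := Ioi (x / 2))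
    (bound := fun r => 2 / x * ‖φ r‖) (Ioi_mem_nhds (by linarith))
    (Eventually.of_forall hmeas) ?_ ?_ ?_ (hφ.norm.const_mul _) ?_
  · refine ⟨by simpa only [IntegrableOn, neg_neg, Pi.neg_def] using h.1.neg, ?_⟩
    rw [← integral_neg]
    exact h.2
  · refine hφ.norm.mono' (hmeas x) ?_
    refine (ae_restrict_mem measurableSet_Ioi).mono fun r hr => ?_
    rw [norm_mul, Real.norm_eq_abs, Real.abs_exp]
    refine mul_le_of_le_one_left (norm_nonneg _) (Real.exp_le_one_iff.2 ?_)
    have : 0 < x * r := mul_pos hx hr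
    linarith
  · exact (AEStronglyMeasurable.mul (Continuous.aestronglyMeasurable (by fun_prop))
      (continuous_id.aestronglyMeasurable.mul hφ.aestronglyMeasurable)).neg
  · refine (ae_restrict_mem measurableSet_Ioi).mono fun r hr y hy => ?_
    have hr' : (0 : ℝ) < r := hr
    have hy' : x / 2 < y := hy
    rw [norm_neg, ← mul_assoc, norm_mul, Real.norm_eq_abs, abs_of_pos (by positivity), mul_comm
      (Real.exp _)]
    refine mul_le_mul_of_nonneg_right ?_ (norm_nonneg _)
    refine (mul_exp_neg_mul_le (by linarith)).trans ?_
    rw [div_le_div_iff₀ (by linarith) hx]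
    linarith
  · refine ae_of_all _ fun r y _ => ?_
    have h1 : HasDerivAt (fun y : ℝ => -y * r) (-1 * r) y := ((hasDerivAt_id y).neg).mul_const r
    have h2 := h1.exp.mul_const (φ r)
    refine h2.congr_deriv ?_
    ring

lemma tendsto_laplace_nhdsGT_one
    (hφ : IntegrableOn (fun r => Real.exp (-1 * r) * φ r) (Ioi 0)) :
    Tendsto (fun x : ℝ => ∫ r in Ioi (0 : ℝ), Real.exp (-x * r) * φ r) (𝓝[>] 1)
      (𝓝 (∫ r in Ioi (0 : ℝ), Real.exp (-1 * r) * φ r)) := by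
  refine tendsto_integral_filter_of_dominated_convergence
    (fun r => ‖Real.exp (-1 * r) * φ r‖) ?_ ?_ hφ.norm ?_
  · refine Eventually.of_forall fun x => ?_
    have h : (fun r => Real.exp (-x * r) * φ r)
        = fun r => Real.exp ((1 - x) * r) * (Real.exp (-1 * r) * φ r) := by
      ext r
      rw [← mul_assoc, ← Real.exp_add]
      ring_nf
    rw [h]
    exact (Continuous.aestronglyMeasurable (by fun_prop)).mul hφ.aestronglyMeasurable
  · filter_upwards [self_mem_nhdsWithin] with x hx
    refine (ae_restrict_mem measurableSet_Ioi).mono fun r hr => ?_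
    have hr' : (0 : ℝ) < r := hr
    have hx' : (1 : ℝ) < x := hx
    rw [norm_mul, norm_mul]
    refine mul_le_mul_of_nonneg_right ?_ (norm_nonneg _)
    rw [Real.norm_eq_abs, Real.norm_eq_abs, Real.abs_exp, Real.abs_exp]
    gcongr
  · refine ae_of_all _ fun r => ?_
    have : Continuous fun x : ℝ => Real.exp (-x * r) * φ r := by fun_prop
    exact (this.tendsto 1).mono_left nhdsWithin_le_nhds

end LaplaceTransform

/-! ### Behaviour of `arcosh` at `1`. -/

lemma tendsto_arcosh_nhdsGT_one : Tendsto Real.arcosh (𝓝[>] 1) (𝓝 0) := by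
  have := Real.continuousOn_arcosh 1 self_mem_Ici
  rw [ContinuousWithinAt, Real.arcosh_zero] at this
  exact this.mono_left (nhdsWithin_mono _ Ioi_subset_Ici_self)

/-- With `s = arcosh x` the product is `s / sinh s`, the inverse of a difference quotient of `sinh`
at `0`. -/
lemma tendsto_arcosh_mul_deriv_arcosh :
    Tendsto (fun x : ℝ => Real.arcosh x * deriv Real.arcosh x) (𝓝[>] 1) (𝓝 1) := by
  have h1 : Tendsto Real.arcosh (𝓝[>] 1) (𝓝[≠] 0) := by
    refine tendsto_nhdsWithin_iff.2 ⟨tendsto_arcosh_nhdsGT_one, ?_⟩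
    filter_upwards [self_mem_nhdsWithin] with x hx
    exact (Real.arcosh_pos hx).ne'
  have h2 := (hasDerivAt_iff_tendsto_slope.1 (Real.hasDerivAt_sinh 0)).inv₀ (by simp)
  rw [Real.cosh_zero, inv_one] at h2
  refine (h2.comp h1).congr' ?_
  filter_upwards [self_mem_nhdsWithin] with x hx
  have hx' : (1 : ℝ) < x := hx
  rw [(Real.hasDerivAt_arcosh hx).deriv, ← Real.sinh_arcosh hx'.le]
  simp [slope_def_field, div_eq_mul_inv]

theorem proposition4p2 (t : ℝ) (ht : 0 < t) :
    (∀ x : ℝ, 1 ≤ x →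
      IntegrableOn (fun r : ℝ => Real.exp (-x * r) * hartmanWatsonTheta r t / r) (Ioi 0) ∧
      ∫ r in Ioi (0 : ℝ), Real.exp (-x * r) * hartmanWatsonTheta r t / r =
        1 / √(2 * Real.pi * t) * Real.exp (-(Real.arcosh x) ^ 2 / (2 * t))) ∧
    (∀ x : ℝ, 1 < x →
      DifferentiableAt ℝ Real.arcosh x ∧
      IntegrableOn (fun r : ℝ => Real.exp (-x * r) * hartmanWatsonTheta r t) (Ioi 0) ∧
      ∫ r in Ioi (0 : ℝ), Real.exp (-x * r) * hartmanWatsonTheta r t =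
        1 / √(2 * Real.pi * t ^ 3) * (Real.arcosh x * deriv Real.arcosh x) *
          Real.exp (-(Real.arcosh x) ^ 2 / (2 * t))) ∧
    -- At the endpoint `x = 1` the product `arcosh x * arcosh' x` is replaced by its limit.
    (Tendsto (fun x : ℝ => Real.arcosh x * deriv Real.arcosh x) (𝓝[>] 1) (𝓝 1) ∧
      IntegrableOn (fun r : ℝ => Real.exp (-r) * hartmanWatsonTheta r t) (Ioi 0) ∧
      ∫ r in Ioi (0 : ℝ), Real.exp (-r) * hartmanWatsonTheta r t =
        1 / √(2 * Real.pi * t ^ 3)) := by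
  have hpi := Real.pi_pos
  -- The case `x = 0` of the Fubini bound; it makes `x = 1` an interior point for
  -- `hasDerivAt_laplace`, which gives absolute convergence there.
  have hφ : IntegrableOn (fun r => hartmanWatsonTheta r t / r) (Ioi 0) := by
    simpa using integrableOn_exp_mul_hartmanWatsonTheta_div ht le_rfl
  have hcancel : ∀ x : ℝ, EqOn
      (fun r => Real.exp (-x * r) * (r * (hartmanWatsonTheta r t / r)))
      (fun r => Real.exp (-x * r) * hartmanWatsonTheta r t) (Ioi 0) := fun x r hr => by
    have hr' : r ≠ 0 := ne_of_gt hr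
    beta_reduce
    rw [mul_div_cancel₀ _ hr']
  have hint : ∀ x : ℝ, 0 < x →
      IntegrableOn (fun r : ℝ => Real.exp (-x * r) * hartmanWatsonTheta r t) (Ioi 0) :=
    fun x hx => (hasDerivAt_laplace hφ hx).1.congr_fun (hcancel x) measurableSet_Ioi
  have hsqrt : √(2 * Real.pi * t ^ 3) = t * √(2 * Real.pi * t) := by
    rw [show 2 * Real.pi * t ^ 3 = t ^ 2 * (2 * Real.pi * t) by ring,
      Real.sqrt_mul (by positivity), Real.sqrt_sq ht.le]
  have hval : ∀ x : ℝ, 1 < x →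
      ∫ r in Ioi (0 : ℝ), Real.exp (-x * r) * hartmanWatsonTheta r t =
        1 / √(2 * Real.pi * t ^ 3) * (Real.arcosh x * deriv Real.arcosh x) *
          Real.exp (-(Real.arcosh x) ^ 2 / (2 * t)) := by
    intro x hx
    have hd := (hasDerivAt_laplace hφ (show 0 < x by linarith)).2
    rw [setIntegral_congr_fun measurableSet_Ioi (hcancel x)] at hd
    have ha := (Real.differentiableAt_arcosh hx).hasDerivAt
    have hd' := (((ha.pow 2).neg.div_const (2 * t)).exp).const_mul (1 / √(2 * Real.pi * t))
    -- The first formula holds on a neighbourhood of `x` because `x > 1`, so the two derivatives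
    -- agree.
    have heq := hd.unique (hd'.congr_of_eventuallyEq (by
      filter_upwards [Ioi_mem_nhds hx] with y hy
      have := integral_exp_mul_hartmanWatsonTheta_div ht (le_of_lt hy)
      simp only [mul_div_assoc] at this ⊢
      exact this))
    have h0 : 0 < √(2 * Real.pi * t) := by positivity
    rw [neg_eq_iff_eq_neg.1 heq, hsqrt]
    simp only [Pi.neg_apply, Pi.pow_apply, Nat.cast_ofNat, Nat.add_one_sub_one, pow_one]
    field_simp
  have hint1 : IntegrableOn (fun r : ℝ => Real.exp (-1 * r) * hartmanWatsonTheta r t) (Ioi 0) :=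
    hint 1 one_pos
  refine ⟨fun x hx => ⟨integrableOn_exp_mul_hartmanWatsonTheta_div ht (by linarith),
    integral_exp_mul_hartmanWatsonTheta_div ht hx⟩, fun x hx =>
    ⟨Real.differentiableAt_arcosh hx, hint x (by linarith), hval x hx⟩,
    tendsto_arcosh_mul_deriv_arcosh, by simpa using hint1, ?_⟩
  have hlim := tendsto_laplace_nhdsGT_one hint1
  have hexp : Tendsto (fun x => Real.exp (-(Real.arcosh x) ^ 2 / (2 * t))) (𝓝[>] 1) (𝓝 1) := by
    have hc : Continuous fun a : ℝ => Real.exp (-a ^ 2 / (2 * t)) := by fun_prop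
    simpa [Function.comp_def] using (hc.tendsto 0).comp tendsto_arcosh_nhdsGT_one
  have hlim' := (tendsto_arcosh_mul_deriv_arcosh.const_mul
    (1 / √(2 * Real.pi * t ^ 3))).mul hexp
  rw [mul_one, mul_one] at hlim'
  have := tendsto_nhds_unique (hlim.congr' (by
    filter_upwards [self_mem_nhdsWithin] with x hx
    exact hval x hx)) hlim'
  simpa using this
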